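/- Let $R$ be a commutative ring that is strongly discrete (there is a membership test for finitely generated ideals which, when $a\in\langle b_1,\dots,b_k\rangle$, provides $c_1,\dots,c_k$ with $a=\sum_i b_ic_i$) and coherent (for all $a_1,\dots,a_k\in R$ the syzygy module $\operatorname{Syz}(a_1,\dots,a_k)=\{b\in R^k : \sum_i b_ia_i=0\}$ is finitely generated). Let $n,m\ge 1$, $R[X]=R[X_1,\dots,X_n]$, and let $(e_1,\dots,e_m)$ be the canonical basis of $R[X]^m$. A monomial of $R[X]^m$ is a vector $X^\alpha e_i$. A monomial order on $R[X]^m$ is a (strict) total order $>$ on its monomials such that $X^\alpha M>M$ whenever $X^\alpha\neq1$, and $M>N$ implies $X^\alpha M>X^\alpha N$. For $u\ne0$, $\operatorname{LM}(u)$ is the greatest monomial occurring in $u$ and $\operatorname{LT}(u)$ is the corresponding term; $\operatorname{LT}(0)=0$. For a submodule $U$, $\operatorname{MLT}(U)=\langle \operatorname{LT}(u) : u\in U\rangle$. A Gröbner basis for $U$ is a finite list $g_1,\dots,g_p$ of nonzero vectors with $U=\langle g_1,\dots,g_p\rangle$ and $\operatorname{MLT}(U)=\langle \operatorname{LT}(g_1),\dots,\operatorname{LT}(g_p)\rangle$.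 Schreyer's monomial order induced by $>$ and $g_1,\dots,g_p$ on $R[X]^p$, with canonical basis $(\epsilon_1,\dots,\epsilon_p)$, is defined by: $X^\alpha\epsilon_k>X^\beta\epsilon_j$ if $\operatorname{LM}(X^\alpha g_k)>\operatorname{LM}(X^\beta g_j)$, or if $\operatorname{LM}(X^\alpha g_k)=\operatorname{LM}(X^\beta g_j)$ and $k<j$. Theorem. Let $>$ be a monomial order on $R[X]^m$, and let $U$ be a finitely generated submodule of $R[X]^m$ such that $\operatorname{MLT}(U)$ is finitely generated. Then $M=R[X]^m/U$ admits a resolution $$0\to F_q/V\to F_{q-1}\to\cdots\to F_1\to F_0\to M\to 0$$ (an exact sequence of $R[X]$-modules) with $1\le q\le n+1$ and with $F_0,\dots,F_q$ finitely generated free $R[X]$-modules, where $V\subseteq F_q$ is generated by finitely many iterated syzygies whose leading terms do not involve any of the variables $X_1,\dots,X_n$. More precisely, there are finite lists $G_0,\dots,G_q$ such that: 1. $F_0=R[X]^m$, and $F_{i+1}=R[X]^{p_i}$, where $p_i$ is the length of the list $G_i$, which consists of nonzero vectors of $F_i$; 2. $G_0$ is a Gröbner basis for $U$ with respect to $>$,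 and, for $0\le i<q$, $G_{i+1}$ is a Gröbner basis for $\operatorname{Syz}(G_i)\subseteq F_{i+1}$ with respect to Schreyer's monomial order induced by the order on $F_i$ and $G_i$; 3. the maps of the resolution are the quotient map $F_0\to M$ and the maps $F_{i+1}\to F_i$ sending the $j$th basis vector to the $j$th item of $G_i$ (for $i+1=q$, the map induced on $F_q/V$); 4. $V=\langle G_q\rangle$, and the leading monomial of each item of $G_q$ with respect to Schreyer's induced order on $F_q$ is one of the basis vectors of $F_q$. -/

import Mathlib

open MvPolynomial

noncomputable section

/-- `Syz(v_1, …, v_k)`, the module of relations `∑ b_i v_i = 0`. -/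
def Syz {A M : Type*} [CommRing A] [AddCommGroup M] [Module A M] {k : ℕ} (v : Fin k → M) :
    Submodule A (Fin k → A) :=
  LinearMap.ker (Fintype.linearCombination A v)

/-- A ring is coherent if the syzygy module of every finite tuple of its elements is
finitely generated. -/
class IsCoherentRing (R : Type*) [CommRing R] : Prop where
  syz_fg : ∀ {k : ℕ} (v : Fin k → R), (Syz (A := R) v).FG

/-- A ring is strongly discrete if it is equipped with a membership test for finitely generated
ideals that produces coefficients when the answer is positive. -/
class StronglyDiscrete (R : Type*) [CommRing R] where
  memTest : ∀ {k : ℕ} (a : R) (b : Fin k → R),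
    (Σ' c : Fin k → R, a = ∑ i, b i * c i) ⊕' (¬ ∃ c : Fin k → R, a = ∑ i, b i * c i)

/-- The free module `R[X_1, …, X_n]^m`. -/
abbrev FreeMod (R : Type*) [CommRing R] (n m : ℕ) : Type _ := Fin m → MvPolynomial (Fin n) R

/-- The monomial `X^α e_i` of `R[X_1, …, X_n]^m`, given by its exponent and its position. -/
abbrev Mon (n m : ℕ) : Type := (Fin n →₀ ℕ) × Fin m

/-- The product `X^α M` of a monomial of `R[X_1, …, X_n]` and a monomial `M`. -/
def Mon.shift {n m : ℕ} (α : Fin n →₀ ℕ) (M : Mon n m) : Mon n m := (α + M.1, M.2)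

/-- A monomial order on `R[X_1, …, X_n]^m`; `gt M N` means `M > N`. -/
structure ModuleMonomialOrder (n m : ℕ) where
  gt : Mon n m → Mon n m → Prop
  irrefl : ∀ M, ¬ gt M M
  trans : ∀ {M N P}, gt M N → gt N P → gt M P
  total : ∀ M N, gt M N ∨ M = N ∨ gt N M
  shift_gt : ∀ (α : Fin n →₀ ℕ) (M : Mon n m), α ≠ 0 → gt (M.shift α) M
  shift_mono : ∀ (α : Fin n →₀ ℕ) (M N : Mon n m), gt M N → gt (M.shift α) (N.shift α)

/-- The coefficient of the vector `u` at the monomial `M`. -/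
def coeffAt {R : Type*} [CommRing R] {n m : ℕ} (u : FreeMod R n m) (M : Mon n m) : R :=
  (u M.2).coeff M.1

/-- The vector `c M`. -/
def termAt {R : Type*} [CommRing R] {n m : ℕ} (c : R) (M : Mon n m) : FreeMod R n m :=
  Pi.single M.2 (monomial M.1 c)

namespace ModuleMonomialOrder

variable {R : Type*} [CommRing R] {n m : ℕ}

/-- `M` is the leading monomial of `u`: it is the greatest monomial that occurs in `u`. -/
def IsLeadingMonomial (o : ModuleMonomialOrder n m) (u : FreeMod R n m) (M : Mon n m) : Prop :=
  coeffAt u M ≠ 0 ∧ ∀ N, coeffAt u N ≠ 0 → N = M ∨ o.gt M N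

theorem exists_isLeadingMonomial (o : ModuleMonomialOrder n m) (u : FreeMod R n m) (hu : u ≠ 0) :
    ∃ M, o.IsLeadingMonomial u M := by
  classical
  have key : ∀ s : Finset (Mon n m), s.Nonempty →
      ∃ M ∈ s, ∀ N ∈ s, N = M ∨ o.gt M N := by
    intro s hs
    induction hs using Finset.Nonempty.cons_induction with
    | singleton a => exact ⟨a, by simp, by simp⟩
    | cons a s ha hs ih =>
      obtain ⟨M, hM, hmax⟩ := ih
      rcases o.total a M with h | h | h
      · refine ⟨a, by simp, fun N hN => ?_⟩
        rcases Finset.mem_cons.1 hN with h1 | h1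
        · exact Or.inl h1
        · rcases hmax N h1 with h2 | h2
          · exact Or.inr (h2 ▸ h)
          · exact Or.inr (o.trans h h2)
      · exact absurd (h ▸ hM) ha
      · refine ⟨M, by simp [hM], fun N hN => ?_⟩
        rcases Finset.mem_cons.1 hN with h1 | h1
        · exact Or.inr (h1 ▸ h)
        · exact hmax N h1
  let s : Finset (Mon n m) :=
    Finset.univ.biUnion fun i => (u i).support.image fun α => (α, i)
  have hs : ∀ M : Mon n m, M ∈ s ↔ coeffAt u M ≠ 0 := by
    rintro ⟨α, i⟩
    simp [s, coeffAt]
  have hne : s.Nonempty := by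
    obtain ⟨i, hi⟩ := Function.ne_iff.1 hu
    obtain ⟨α, hα⟩ := MvPolynomial.ne_zero_iff.1 hi
    exact ⟨(α, i), (hs _).2 hα⟩
  obtain ⟨M, hM, hmax⟩ := key s hne
  exact ⟨M, (hs M).1 hM, fun N hN => hmax N ((hs N).2 hN)⟩

/-- The leading monomial `LM(u)` of a nonzero vector `u`. -/
def lm (o : ModuleMonomialOrder n m) (u : FreeMod R n m) (hu : u ≠ 0) : Mon n m :=
  (o.exists_isLeadingMonomial u hu).choose

open Classical in
/-- The leading term `LT(u)`, with `LT(0) = 0`. -/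
def lt (o : ModuleMonomialOrder n m) (u : FreeMod R n m) : FreeMod R n m :=
  if hu : u = 0 then 0 else termAt (coeffAt u (o.lm u hu)) (o.lm u hu)

/-- The module `MLT(U)` of leading terms of a submodule `U`. -/
def mlt (o : ModuleMonomialOrder n m) (U : Submodule (MvPolynomial (Fin n) R) (FreeMod R n m)) :
    Submodule (MvPolynomial (Fin n) R) (FreeMod R n m) :=
  Submodule.span _ (o.lt '' (U : Set (FreeMod R n m)))

/-- The list `g` is a Gröbner basis for `U`: it generates `U`, it consists of nonzero vectors,
and its leading terms generate `MLT(U)`. -/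
structure IsGroebnerBasis (o : ModuleMonomialOrder n m)
    (U : Submodule (MvPolynomial (Fin n) R) (FreeMod R n m)) {p : ℕ} (g : Fin p → FreeMod R n m) :
    Prop where
  ne_zero : ∀ j, g j ≠ 0
  span_eq : Submodule.span (MvPolynomial (Fin n) R) (Set.range g) = U
  mlt_eq : o.mlt U = Submodule.span _ (Set.range fun j => o.lt (g j))

/-- Schreyer's monomial order on `R[X_1, …, X_n]^p` induced by `>` and a list of monomials
`L_1, …, L_p`: `X^α ε_k` is greater than `X^β ε_j` if `X^α L_k > X^β L_j`, or if
`X^α L_k = X^β L_j` and `k < j`. -/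
def schreyerOfMon (o : ModuleMonomialOrder n m) {p : ℕ} (L : Fin p → Mon n m) :
    ModuleMonomialOrder n p where
  gt A B := o.gt ((L A.2).shift A.1) ((L B.2).shift B.1) ∨
    ((L A.2).shift A.1 = (L B.2).shift B.1 ∧ A.2 < B.2)
  irrefl M h := by
    rcases h with h | h
    · exact o.irrefl _ h
    · exact lt_irrefl _ h.2
  trans {M N P} h1 h2 := by
    rcases h1 with h1 | ⟨h1, k1⟩ <;> rcases h2 with h2 | ⟨h2, k2⟩
    · exact Or.inl (o.trans h1 h2)
    · exact Or.inl (h2 ▸ h1)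
    · exact Or.inl (h1 ▸ h2)
    · exact Or.inr ⟨h1.trans h2, k1.trans k2⟩
  total M N := by
    rcases o.total ((L M.2).shift M.1) ((L N.2).shift N.1) with h | h | h
    · exact Or.inl (Or.inl h)
    · rcases lt_trichotomy M.2 N.2 with k | k | k
      · exact Or.inl (Or.inr ⟨h, k⟩)
      · refine Or.inr (Or.inl (Prod.ext ?_ k))
        rw [k] at h
        exact add_right_cancel (congrArg Prod.fst h)
      · exact Or.inr (Or.inr (Or.inr ⟨h.symm, k⟩))
    · exact Or.inr (Or.inr (Or.inl h))
  shift_gt α M hα := by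
    refine Or.inl ?_
    have := o.shift_gt α ((L M.2).shift M.1) hα
    simpa [Mon.shift, add_assoc] using this
  shift_mono α M N h := by
    rcases h with h | ⟨h, k⟩
    · refine Or.inl ?_
      have := o.shift_mono α _ _ h
      simpa [Mon.shift, add_assoc] using this
    · refine Or.inr ⟨?_, k⟩
      have := congrArg (Mon.shift α) h
      simpa [Mon.shift, add_assoc] using this

/-- Schreyer's monomial order induced by `>` and a list `g` of nonzero vectors. It only depends
on the leading monomials of `g`, because `LM(X^α g_k) = X^α LM(g_k)`. -/
def schreyer (o : ModuleMonomialOrder n m) {p : ℕ} (g : Fin p → FreeMod R n m)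
    (hg : ∀ j, g j ≠ 0) : ModuleMonomialOrder n p :=
  o.schreyerOfMon fun j => o.lm (g j) (hg j)

end ModuleMonomialOrder

/-- The ranks of the free modules `F_0, F_1, F_2, …`, namely `m, p 0, p 1, …`. -/
def towerRank (m : ℕ) (p : ℕ → ℕ) : ℕ → ℕ
  | 0 => m
  | i + 1 => p i

/-- Lists `G_0, G_1, …` of nonzero vectors, where `G_0` lies in `F_0 = R[X_1, …, X_n]^m` and
`G_{i+1}` lies in the free module `F_{i+1}` whose basis is indexed by the list `G_i`. -/
structure Tower (R : Type*) [CommRing R] (n m : ℕ) where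
  p : ℕ → ℕ
  G : ∀ i, Fin (p i) → FreeMod R n (towerRank m p i)
  ne_zero : ∀ i j, G i j ≠ 0

namespace Tower

variable {R : Type*} [CommRing R] {n m : ℕ}

/-- The finitely generated free module `F_i`. -/
abbrev F (T : Tower R n m) (i : ℕ) : Type _ := FreeMod R n (towerRank m T.p i)

/-- The linear map `F_{i+1} → F_i` that sends the `j`th basis vector to the `j`th item of `G_i`. -/
def d (T : Tower R n m) (i : ℕ) : T.F (i + 1) →ₗ[MvPolynomial (Fin n) R] T.F i :=
  Fintype.linearCombination (MvPolynomial (Fin n) R) (T.G i)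

/-- The submodule of `F_i` generated by the list `G_i`. -/
def gen (T : Tower R n m) (i : ℕ) : Submodule (MvPolynomial (Fin n) R) (T.F i) :=
  Submodule.span _ (Set.range (T.G i))

/-- The monomial orders on `F_0, F_1, …`: the given one on `F_0`, and on `F_{i+1}` Schreyer's
monomial order induced by the order on `F_i` and by the list `G_i`. -/
def order (T : Tower R n m) (o : ModuleMonomialOrder n m) :
    ∀ i, ModuleMonomialOrder n (towerRank m T.p i)
  | 0 => o
  | i + 1 => (T.order o i).schreyer (T.G i) (T.ne_zero i)

/-- `G_0, …, G_q` are iterated Gröbner bases of syzygies starting from `U`: the list `G_0` is a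
Gröbner basis for `U` with respect to the given monomial order, and, for `i < q`, the list
`G_{i+1}` is a Gröbner basis for `Syz(G_i)` with respect to Schreyer's induced order. -/
def IsIteratedSyzygies (T : Tower R n m) (o : ModuleMonomialOrder n m)
    (U : Submodule (MvPolynomial (Fin n) R) (FreeMod R n m)) (q : ℕ) : Prop :=
  o.IsGroebnerBasis U (T.G 0) ∧
    ∀ i < q, (T.order o (i + 1)).IsGroebnerBasis
      (Syz (A := MvPolynomial (Fin n) R) (T.G i)) (T.G (i + 1))

/-- The sequence `0 → F_{k+1}/V → F_k → ⋯ → F_1 → F_0 → F_0/U → 0` is well defined and exact,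
where `V` is the submodule of `F_{k+1}` generated by the list `G_{k+1}`. Note that the map
`F_{k+1}/V → F_k` has the same range as the map `F_{k+1} → F_k` that induces it. -/
def IsResolution (T : Tower R n m)
    (U : Submodule (MvPolynomial (Fin n) R) (FreeMod R n m)) (k : ℕ) : Prop :=
  (∃ h : T.gen (k + 1) ≤ LinearMap.ker (T.d k),
      Function.Injective ((T.gen (k + 1)).liftQ (T.d k) h)) ∧
    (∀ i < k, Function.Exact (T.d (i + 1)) (T.d i)) ∧
    Function.Exact (T.d 0) U.mkQ ∧
    Function.Surjective U.mkQ

end Tower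

end

/-! The resolution comes from iterating Schreyer's theorem, with each Gröbner basis suitably sorted.
Let `L_j` be the leading monomials of a Gröbner basis `g`. The syzygies of `g` have a Gröbner basis
whose leading monomials are `(lcm(L_j : j ∈ E) / L_k) ε_k` with `k = min E`
(`exists_finite_mlt_syz`). If `g` is listed with decreasing exponents of a variable, then `L_k` has
the largest exponent among the `L_j`, `j ∈ E`, so that variable cancels from the quotient; a
variable absent from all `L_j` stays absent. Each step thus removes one variable (`exists_next`).

Over a ring with zero divisors, pairs `E` do not suffice. All relations among the leading
coefficients indexed by `E` matter, and coherence makes the ideal of their `k`th entries finitely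
generated. Its generators lift to syzygies by division (`exists_syzygy`). Conversely, the leading
coefficient of any syzygy lies in such an ideal, as comparing coefficients at its top monomial
shows. -/

noncomputable section

/-! ### Monomials, divisibility and coefficients -/

/-- The monomial `L` divides the monomial `M`. -/
def Mon.Dvd {n m : ℕ} (L M : Mon n m) : Prop := L.2 = M.2 ∧ L.1 ≤ M.1

theorem Mon.Dvd.shift_sub {n m : ℕ} {L M : Mon n m} (h : L.Dvd M) :
    L.shift (M.1 - L.1) = M :=
  Prod.ext (tsub_add_cancel_of_le h.2) h.1

theorem Mon.dvd_shift {n m : ℕ} (L : Mon n m) (α : Fin n →₀ ℕ) : L.Dvd (L.shift α) :=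
  ⟨rfl, le_add_self⟩

section coeffAt

variable {R : Type*} [CommRing R] {n m : ℕ}

theorem coeffAt_add (u v : FreeMod R n m) (M : Mon n m) :
    coeffAt (u + v) M = coeffAt u M + coeffAt v M := by
  simp [coeffAt]

theorem coeffAt_sub (u v : FreeMod R n m) (M : Mon n m) :
    coeffAt (u - v) M = coeffAt u M - coeffAt v M := by
  simp [coeffAt]

theorem coeffAt_sum {ι : Type*} (s : Finset ι) (u : ι → FreeMod R n m) (M : Mon n m) :
    coeffAt (∑ i ∈ s, u i) M = ∑ i ∈ s, coeffAt (u i) M := by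
  simp [coeffAt, coeff_sum]

theorem ne_zero_of_coeffAt {u : FreeMod R n m} {M : Mon n m} (h : coeffAt u M ≠ 0) : u ≠ 0 := by
  rintro rfl
  simp [coeffAt] at h

open Classical in
theorem coeffAt_termAt (c : R) (L M : Mon n m) :
    coeffAt (termAt c L) M = if L = M then c else 0 := by
  by_cases h : L.2 = M.2
  · simp [coeffAt, termAt, h, Prod.ext_iff]
  · simp [coeffAt, termAt, h, Prod.ext_iff]

open Classical in
theorem coeffAt_smul_termAt (f : MvPolynomial (Fin n) R) (c : R) (L M : Mon n m) :
    coeffAt (f • termAt c L) M = if L.Dvd M then f.coeff (M.1 - L.1) * c else 0 := by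
  by_cases h : L.2 = M.2
  · simp [coeffAt, termAt, h, Mon.Dvd, coeff_mul_monomial']
  · simp [coeffAt, termAt, h, Mon.Dvd]

theorem exists_of_coeffAt_smul_ne_zero {f : MvPolynomial (Fin n) R} {v : FreeMod R n m}
    {N : Mon n m} (h : coeffAt (f • v) N ≠ 0) :
    ∃ α B, f.coeff α ≠ 0 ∧ coeffAt v B ≠ 0 ∧ B.shift α = N := by
  classical
  have h' : (f * v N.2).coeff N.1 ≠ 0 := h
  rw [coeff_mul] at h'
  obtain ⟨x, hx, hne⟩ := Finset.exists_ne_zero_of_sum_ne_zero h'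
  exact ⟨x.1, (x.2, N.2), left_ne_zero_of_mul hne, right_ne_zero_of_mul hne,
    Prod.ext (Finset.HasAntidiagonal.mem_antidiagonal.1 hx) rfl⟩

theorem smul_termAt (α : Fin n →₀ ℕ) (r c : R) (M : Mon n m) :
    monomial α r • termAt c M = termAt (r * c) (M.shift α) := by
  simp [termAt, Mon.shift, ← Pi.single_smul, monomial_mul]

end coeffAt

/-! ### Monomial orders and leading monomials -/

namespace ModuleMonomialOrder

variable {R : Type*} [CommRing R] {n m p : ℕ}

/-- The non-strict version of a monomial order: `N` is at most `M`. -/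
def Le (o : ModuleMonomialOrder n m) (N M : Mon n m) : Prop := N = M ∨ o.gt M N

theorem Le.antisymm {o : ModuleMonomialOrder n m} {M N : Mon n m} (h : o.Le M N)
    (h' : o.Le N M) : M = N := by
  rcases h with h | h
  · exact h
  · rcases h' with h' | h'
    · exact h'.symm
    · exact absurd (o.trans h h') (o.irrefl _)

theorem gt_of_gt_of_le {o : ModuleMonomialOrder n m} {M N P : Mon n m} (h : o.gt M N)
    (h' : o.Le P N) : o.gt M P := by
  rcases h' with rfl | h'
  · exact h
  · exact o.trans h h'

theorem Le.shift {o : ModuleMonomialOrder n m} {M N : Mon n m} (h : o.Le M N)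
    (α : Fin n →₀ ℕ) : o.Le (M.shift α) (N.shift α) := by
  rcases h with rfl | h
  · exact Or.inl rfl
  · exact Or.inr (o.shift_mono α _ _ h)

theorem le_of_dvd (o : ModuleMonomialOrder n m) {L M : Mon n m} (h : L.Dvd M) : o.Le L M := by
  by_cases h0 : M.1 - L.1 = 0
  · left
    have := h.shift_sub
    rw [h0] at this
    simpa [Mon.shift] using this
  · right
    have := o.shift_gt _ L h0
    rwa [h.shift_sub] at this

/-- Dickson's lemma, with equality on positions: in a descending chain some term would divide a
later one, hence be at most that later, smaller term. -/
theorem wellFounded_gt (o : ModuleMonomialOrder n m) :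
    WellFounded fun N M : Mon n m => o.gt M N := by
  rw [wellFounded_iff_isEmpty_descending_chain]
  refine ⟨fun ⟨f, hf⟩ => ?_⟩
  have hlt : ∀ i j, i < j → o.gt (f i) (f j) := by
    intro i j hij
    induction j, hij using Nat.le_induction with
    | base => exact hf i
    | succ j _ ih => exact o.trans ih (hf j)
  have wqo := WellQuasiOrdered.prod (wellQuasiOrdered_le (α := Fin n →₀ ℕ))
    (Finite.wellQuasiOrdered (Eq : Fin m → Fin m → Prop))
  obtain ⟨i, j, hij, h1, h2⟩ := wqo f
  exact o.irrefl _ (gt_of_gt_of_le (hlt i j hij) (o.le_of_dvd ⟨h2, h1⟩))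

theorem IsLeadingMonomial.unique {o : ModuleMonomialOrder n m} {u : FreeMod R n m}
    {M N : Mon n m} (hM : o.IsLeadingMonomial u M) (hN : o.IsLeadingMonomial u N) : M = N :=
  Le.antisymm (hN.2 M hM.1) (hM.2 N hN.1)

theorem isLeadingMonomial_lm (o : ModuleMonomialOrder n m) (u : FreeMod R n m) (hu : u ≠ 0) :
    o.IsLeadingMonomial u (o.lm u hu) :=
  (o.exists_isLeadingMonomial u hu).choose_spec

theorem IsLeadingMonomial.lm_eq {o : ModuleMonomialOrder n m} {u : FreeMod R n m}
    {M : Mon n m} (hM : o.IsLeadingMonomial u M) (hu : u ≠ 0) : o.lm u hu = M :=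
  (o.isLeadingMonomial_lm u hu).unique hM

theorem IsLeadingMonomial.lt_eq {o : ModuleMonomialOrder n m} {u : FreeMod R n m}
    {M : Mon n m} (hM : o.IsLeadingMonomial u M) : o.lt u = termAt (coeffAt u M) M := by
  have hu := ne_zero_of_coeffAt hM.1
  rw [lt, dif_neg hu, hM.lm_eq hu]

theorem le_of_coeffAt_smul_ne_zero {o : ModuleMonomialOrder n m} {v : FreeMod R n m}
    {L : Mon n m} (hL : o.IsLeadingMonomial v L) {f : MvPolynomial (Fin n) R} {N : Mon n m}
    (h : coeffAt (f • v) N ≠ 0) : ∃ α, f.coeff α ≠ 0 ∧ o.Le N (L.shift α) := by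
  obtain ⟨α, B, hα, hB, rfl⟩ := exists_of_coeffAt_smul_ne_zero h
  exact ⟨α, hα, Le.shift (hL.2 B hB) α⟩

-- A non-leading monomial `B` of `v` satisfies `X^α B < X^α L ≤ M`, so only the leading term of `v`
-- can contribute at `M`.
open Classical in
theorem coeffAt_smul_top {o : ModuleMonomialOrder n m} {v : FreeMod R n m} {L M : Mon n m}
    (hL : o.IsLeadingMonomial v L) {f : MvPolynomial (Fin n) R}
    (hf : ∀ α, f.coeff α ≠ 0 → o.Le (L.shift α) M) :
    coeffAt (f • v) M = if L.Dvd M then f.coeff (M.1 - L.1) * coeffAt v L else 0 := by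
  have key : coeffAt (f • (v - termAt (coeffAt v L) L)) M = 0 := by
    by_contra h
    obtain ⟨α, B, hα, hB, hM⟩ := exists_of_coeffAt_smul_ne_zero h
    rw [coeffAt_sub, coeffAt_termAt] at hB
    have hBL : B ≠ L := by
      rintro rfl
      simp at hB
    have hv : coeffAt v B ≠ 0 := by
      rwa [if_neg hBL.symm, sub_zero] at hB
    rcases hL.2 B hv with h1 | h1
    · exact hBL h1
    · have h2 := o.shift_mono α _ _ h1
      rw [hM] at h2
      exact o.irrefl _ (gt_of_gt_of_le h2 (hf α hα))
  rw [smul_sub, coeffAt_sub, sub_eq_zero] at key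
  rw [key, coeffAt_smul_termAt]

/-! ### Linear combinations bounded by a monomial -/

variable (g : Fin p → FreeMod R n m) (L : Fin p → Mon n m)

theorem coeffAt_linearCombination (h : FreeMod R n p) (N : Mon n m) :
    coeffAt (Fintype.linearCombination (MvPolynomial (Fin n) R) g h) N =
      ∑ j, coeffAt (h j • g j) N := by
  rw [Fintype.linearCombination_apply, coeffAt_sum]

variable {g L}

theorem le_of_coeffAt_linearCombination_ne_zero {o : ModuleMonomialOrder n m}
    (hL : ∀ j, o.IsLeadingMonomial (g j) (L j)) {h : FreeMod R n p} {N : Mon n m}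
    (hN : coeffAt (Fintype.linearCombination (MvPolynomial (Fin n) R) g h) N ≠ 0) :
    ∃ A : Mon n p, coeffAt h A ≠ 0 ∧ o.Le N ((L A.2).shift A.1) := by
  rw [coeffAt_linearCombination] at hN
  obtain ⟨j, -, hj⟩ := Finset.exists_ne_zero_of_sum_ne_zero hN
  obtain ⟨α, hα, hle⟩ := le_of_coeffAt_smul_ne_zero (hL j) hj
  exact ⟨(α, j), hα, hle⟩

open Classical in
theorem coeffAt_linearCombination_top {o : ModuleMonomialOrder n m}
    (hL : ∀ j, o.IsLeadingMonomial (g j) (L j)) {h : FreeMod R n p} {M : Mon n m}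
    (hM : ∀ A : Mon n p, coeffAt h A ≠ 0 → o.Le ((L A.2).shift A.1) M) :
    coeffAt (Fintype.linearCombination (MvPolynomial (Fin n) R) g h) M =
      ∑ j, if (L j).Dvd M then (h j).coeff (M.1 - (L j).1) * coeffAt (g j) (L j) else 0 := by
  rw [coeffAt_linearCombination]
  exact Finset.sum_congr rfl fun j _ => coeffAt_smul_top (hL j) fun α hα => hM (α, j) hα

/-- The vector `∑ a_j (M / L_j) ε_j`. -/
def cofactor (L : Fin p → Mon n m) (M : Mon n m) (a : Fin p → R) : FreeMod R n p :=
  fun j => monomial (M.1 - (L j).1) (a j)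

theorem coeffAt_cofactor_of_shift_eq {M : Mon n m} {a : Fin p → R} {A : Mon n p}
    (hA : (L A.2).shift A.1 = M) : coeffAt (cofactor L M a) A = a A.2 := by
  have : M.1 - (L A.2).1 = A.1 := by
    rw [← hA]
    exact add_tsub_cancel_right _ _
  simp [coeffAt, cofactor, this]

theorem of_coeffAt_cofactor_ne_zero {M : Mon n m} {a : Fin p → R}
    (ha : ∀ j, a j ≠ 0 → (L j).Dvd M) {A : Mon n p} (h : coeffAt (cofactor L M a) A ≠ 0) :
    (L A.2).shift A.1 = M := by
  classical
  simp only [coeffAt, cofactor, coeff_monomial, ne_eq, ite_eq_right_iff, Classical.not_imp] at h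
  rw [← h.1]
  exact (ha _ h.2).shift_sub

theorem coeffAt_linearCombination_cofactor {o : ModuleMonomialOrder n m}
    (hL : ∀ j, o.IsLeadingMonomial (g j) (L j)) {M : Mon n m} {a : Fin p → R}
    (ha : ∀ j, a j ≠ 0 → (L j).Dvd M) :
    coeffAt (Fintype.linearCombination (MvPolynomial (Fin n) R) g (cofactor L M a)) M =
      ∑ j, a j * coeffAt (g j) (L j) := by
  classical
  rw [coeffAt_linearCombination_top hL
    fun A hA => Or.inl (of_coeffAt_cofactor_ne_zero ha hA)]
  refine Finset.sum_congr rfl fun j _ => ?_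
  split_ifs with hd
  · simp [cofactor]
  · rw [not_imp_comm.1 (ha j) hd, zero_mul]

theorem le_of_coeffAt_linearCombination_cofactor {o : ModuleMonomialOrder n m}
    (hL : ∀ j, o.IsLeadingMonomial (g j) (L j)) {M : Mon n m} {a : Fin p → R}
    (ha : ∀ j, a j ≠ 0 → (L j).Dvd M) {N : Mon n m}
    (hN : coeffAt (Fintype.linearCombination (MvPolynomial (Fin n) R) g (cofactor L M a)) N ≠ 0) :
    o.Le N M := by
  obtain ⟨A, hA, hle⟩ := le_of_coeffAt_linearCombination_ne_zero hL hN
  rwa [of_coeffAt_cofactor_ne_zero ha hA] at hle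

/-- A leading term in the module generated by finitely many leading terms has a leading
coefficient that is a combination of the leading coefficients whose monomials divide it. -/
theorem exists_coeff_of_mem_span_lt {o : ModuleMonomialOrder n m}
    (hL : ∀ j, o.IsLeadingMonomial (g j) (L j)) {c : R} {M : Mon n m}
    (h : termAt c M ∈ Submodule.span (MvPolynomial (Fin n) R) (Set.range fun j => o.lt (g j))) :
    ∃ a : Fin p → R, (∀ j, a j ≠ 0 → (L j).Dvd M) ∧ ∑ j, a j * coeffAt (g j) (L j) = c := by
  classical
  obtain ⟨f, hf⟩ := (Submodule.mem_span_range_iff_exists_fun _).1 h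
  refine ⟨fun j => if (L j).Dvd M then (f j).coeff (M.1 - (L j).1) else 0, ?_, ?_⟩
  · intro j hj
    by_contra hd
    exact hj (if_neg hd)
  · have hc : coeffAt (termAt c M) M = c := by simp [coeffAt, termAt]
    rw [← hc, ← hf, coeffAt_sum]
    refine Finset.sum_congr rfl fun j _ => ?_
    rw [(hL j).lt_eq, coeffAt_smul_termAt, ite_mul, zero_mul]

/-! ### Division and lifting of relations -/

variable {U : Submodule (MvPolynomial (Fin n) R) (FreeMod R n m)}

/-- The division algorithm. -/
theorem exists_division {o : ModuleMonomialOrder n m}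
    (hL : ∀ j, o.IsLeadingMonomial (g j) (L j)) (hg : ∀ j, g j ∈ U)
    (hU : o.mlt U ≤ Submodule.span _ (Set.range fun j => o.lt (g j))) :
    ∀ (M : Mon n m) (u : FreeMod R n m), u ∈ U → o.IsLeadingMonomial u M →
      ∃ h : FreeMod R n p, Fintype.linearCombination (MvPolynomial (Fin n) R) g h = u ∧
        ∀ A : Mon n p, coeffAt h A ≠ 0 → o.Le ((L A.2).shift A.1) M := by
  intro M
  induction M using o.wellFounded_gt.induction with
  | _ M ih =>
    intro u hu hM
    have hmem : termAt (coeffAt u M) M ∈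
        Submodule.span (MvPolynomial (Fin n) R) (Set.range fun j => o.lt (g j)) := by
      rw [← hM.lt_eq]
      exact hU (Submodule.subset_span ⟨u, hu, rfl⟩)
    obtain ⟨a, ha, hsum⟩ := exists_coeff_of_mem_span_lt hL hmem
    set w := Fintype.linearCombination (MvPolynomial (Fin n) R) g (cofactor L M a) with hw
    have hwU : w ∈ U := by
      rw [hw, Fintype.linearCombination_apply]
      exact Submodule.sum_mem _ fun j _ => U.smul_mem _ (hg j)
    by_cases h0 : u - w = 0
    · exact ⟨_, (sub_eq_zero.1 h0).symm,
        fun A hA => Or.inl (of_coeffAt_cofactor_ne_zero ha hA)⟩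
    · obtain ⟨N, hN⟩ := o.exists_isLeadingMonomial _ h0
      -- `u` and `w` have the same coefficient at `M` and no monomial above `M`, so the remainder is
      -- strictly smaller.
      have hgt : o.gt M N := by
        have hne := hN.1
        have hNM : N ≠ M := by
          rintro rfl
          rw [coeffAt_sub, coeffAt_linearCombination_cofactor hL ha, hsum, sub_self] at hne
          exact hne rfl
        have hle : o.Le N M := by
          by_cases h1 : coeffAt u N = 0
          · rw [coeffAt_sub, h1, zero_sub, neg_ne_zero] at hne
            exact le_of_coeffAt_linearCombination_cofactor hL ha hne
          · exact hM.2 N h1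
        exact hle.resolve_left hNM
      obtain ⟨h, hh, hle⟩ := ih N hgt _ (U.sub_mem hu hwU) hN
      refine ⟨h + cofactor L M a, ?_, fun A hA => ?_⟩
      · rw [map_add, hh, sub_add_cancel]
      · by_cases h1 : coeffAt h A = 0
        · rw [coeffAt_add, h1, zero_add] at hA
          exact Or.inl (of_coeffAt_cofactor_ne_zero ha hA)
        · exact Or.inr (gt_of_gt_of_le hgt (hle A h1))

/-- Vectors of `U` whose leading terms generate `MLT(U)` generate `U`. -/
theorem isGroebnerBasis_of_mlt_le {o : ModuleMonomialOrder n m} (hne : ∀ j, g j ≠ 0)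
    (hg : ∀ j, g j ∈ U) (hU : o.mlt U ≤ Submodule.span _ (Set.range fun j => o.lt (g j))) :
    o.IsGroebnerBasis U g where
  ne_zero := hne
  span_eq := by
    refine le_antisymm (Submodule.span_le.2 (Set.range_subset_iff.2 hg)) fun u hu => ?_
    by_cases h0 : u = 0
    · rw [h0]
      exact zero_mem _
    · obtain ⟨h, hh, -⟩ := exists_division (fun j => o.isLeadingMonomial_lm (g j) (hne j)) hg hU
        _ u hu (o.isLeadingMonomial_lm u h0)
      rw [← Fintype.range_linearCombination]
      exact ⟨h, hh⟩
  mlt_eq := le_antisymm hU (Submodule.span_le.2 (Set.range_subset_iff.2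
    fun j => Submodule.subset_span ⟨g j, hg j, rfl⟩))

/-- A relation between leading terms lifts to a syzygy. -/
theorem exists_syzygy {o : ModuleMonomialOrder n m} (hb : o.IsGroebnerBasis U g)
    (hL : ∀ j, o.IsLeadingMonomial (g j) (L j)) {M : Mon n m} {a : Fin p → R}
    (ha : ∀ j, a j ≠ 0 → (L j).Dvd M) (hsum : ∑ j, a j * coeffAt (g j) (L j) = 0) {k : Fin p}
    (hk : a k ≠ 0) (hmin : ∀ j < k, a j = 0) :
    ∃ s ∈ Syz (A := MvPolynomial (Fin n) R) g,
      (o.schreyerOfMon L).IsLeadingMonomial s (M.1 - (L k).1, k) ∧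
      coeffAt s (M.1 - (L k).1, k) = a k := by
  have hg : ∀ j, g j ∈ U := fun j => hb.span_eq ▸ Submodule.subset_span ⟨j, rfl⟩
  set w := Fintype.linearCombination (MvPolynomial (Fin n) R) g (cofactor L M a) with hw
  have hwU : w ∈ U := by
    rw [hw, Fintype.linearCombination_apply]
    exact Submodule.sum_mem _ fun j _ => U.smul_mem _ (hg j)
  -- The relation `hsum` cancels the coefficient of `w` at `M`, so dividing `w` involves only terms
  -- strictly below `M`; subtracting `h` then leaves the terms at `M` intact.
  obtain ⟨h, hh, hlt⟩ : ∃ h : FreeMod R n p,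
      Fintype.linearCombination (MvPolynomial (Fin n) R) g h = w ∧
        ∀ A : Mon n p, coeffAt h A ≠ 0 → o.gt M ((L A.2).shift A.1) := by
    by_cases h0 : w = 0
    · exact ⟨0, by rw [map_zero, h0], fun A hA => absurd (by simp [coeffAt]) hA⟩
    · obtain ⟨N, hN⟩ := o.exists_isLeadingMonomial _ h0
      obtain ⟨h, hh, hle⟩ := exists_division hL hg hb.mlt_eq.le N w hwU hN
      refine ⟨h, hh, fun A hA => gt_of_gt_of_le ?_ (hle A hA)⟩
      refine (le_of_coeffAt_linearCombination_cofactor hL ha hN.1).resolve_left ?_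
      rintro rfl
      exact hN.1 (by rw [coeffAt_linearCombination_cofactor hL ha, hsum])
  have htop : ∀ A : Mon n p, (L A.2).shift A.1 = M →
      coeffAt (cofactor L M a - h) A = a A.2 := by
    intro A hA
    have h0 : coeffAt h A = 0 := by
      by_contra h1
      exact o.irrefl _ (hA ▸ hlt A h1)
    rw [coeffAt_sub, coeffAt_cofactor_of_shift_eq hA, h0, sub_zero]
  have hkM : (L k).shift (M.1 - (L k).1) = M := (ha k hk).shift_sub
  have hval := htop (M.1 - (L k).1, k) hkM
  refine ⟨cofactor L M a - h, ?_, ⟨by rwa [hval], fun A hA => ?_⟩, hval⟩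
  · rw [Syz, LinearMap.mem_ker, map_sub, hh, sub_self]
  · by_cases h1 : (L A.2).shift A.1 = M
    · rw [htop A h1] at hA
      have hle : k ≤ A.2 := not_lt.1 fun hlt => hA (hmin _ hlt)
      rcases hle.eq_or_lt with h2 | h2
      · left
        refine Prod.ext ?_ h2.symm
        simp only
        rw [← h1, h2]
        exact (add_tsub_cancel_right _ _).symm
      · exact Or.inr (Or.inr ⟨hkM.trans h1.symm, h2⟩)
    · right
      left
      simp only
      rw [hkM]
      apply hlt
      intro h0
      rw [coeffAt_sub, h0, sub_zero] at hA
      exact h1 (of_coeffAt_cofactor_ne_zero ha hA)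

end ModuleMonomialOrder

/-! ### Sorted Gröbner bases -/

theorem exists_antitone_enumeration {α : Type*} {S : Set α} (hS : S.Finite) (f : α → ℕ) :
    ∃ (p : ℕ) (g : Fin p → α), Set.range g = S ∧ Antitone (f ∘ g) := by
  obtain ⟨p, e, -, rfl⟩ := hS.fin_param
  refine ⟨p, e ∘ Tuple.sort (OrderDual.toDual ∘ f ∘ e), (Equiv.surjective _).range_comp e, ?_⟩
  exact Tuple.monotone_sort (OrderDual.toDual ∘ f ∘ e)

namespace ModuleMonomialOrder

variable {R : Type*} [CommRing R] {n m p : ℕ}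
  {U : Submodule (MvPolynomial (Fin n) R) (FreeMod R n m)}

/-- A finite set of vectors whose leading terms generate `MLT(U)` can be listed as a Gröbner basis
in decreasing order of any numerical function of the leading monomials. -/
theorem exists_isGroebnerBasis_antitone {o : ModuleMonomialOrder n m} {S : Set (FreeMod R n m)}
    (hS : S.Finite) (hSU : S ⊆ U) (hne : ∀ s ∈ S, s ≠ 0)
    (hspan : o.mlt U ≤ Submodule.span _ (o.lt '' S)) (key : Mon n m → ℕ) :
    ∃ (p : ℕ) (g : Fin p → FreeMod R n m) (hg : ∀ j, g j ≠ 0), o.IsGroebnerBasis U g ∧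
      (∀ j, g j ∈ S) ∧ Antitone fun j => key (o.lm (g j) (hg j)) := by
  classical
  obtain ⟨p, g, rfl, hanti⟩ := exists_antitone_enumeration hS
    fun s => if h : s = 0 then 0 else key (o.lm s h)
  have hg : ∀ j, g j ≠ 0 := fun j => hne _ ⟨j, rfl⟩
  refine ⟨p, g, hg, isGroebnerBasis_of_mlt_le hg (fun j => hSU ⟨j, rfl⟩) ?_, fun j => ⟨j, rfl⟩,
    fun i j hij => ?_⟩
  · rwa [← Set.range_comp] at hspan
  · simpa [hg] using hanti hij

theorem exists_finite_of_mlt_fg {o : ModuleMonomialOrder n m} (hU : (o.mlt U).FG) :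
    ∃ S : Set (FreeMod R n m), S.Finite ∧ S ⊆ U ∧ (∀ s ∈ S, s ≠ 0) ∧
      o.mlt U ≤ Submodule.span _ (o.lt '' S) := by
  classical
  obtain ⟨T, hT, hspan⟩ := (Submodule.fg_span_iff_fg_span_finset_subset _).1 hU
  obtain ⟨S, hSU, rfl⟩ := Finset.subset_set_image_iff.1 hT
  refine ⟨↑S \ {0}, S.finite_toSet.sdiff, Set.sdiff_subset.trans hSU, fun s hs => hs.2, ?_⟩
  refine hspan.le.trans (Submodule.span_le.2 ?_)
  rw [Finset.coe_image]
  rintro _ ⟨s, hs, rfl⟩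
  by_cases h0 : s = 0
  · simp [h0, lt]
  · exact Submodule.subset_span ⟨s, ⟨hs, h0⟩, rfl⟩

/-! ### Schreyer's theorem over a coherent ring -/

/-- The least common multiple of the monomials `L_j`, `j ∈ E`, at the position of `L_k`. -/
def lcmMon (L : Fin p → Mon n m) (k : Fin p) (E : Finset (Fin p)) : Mon n m :=
  (E.sup fun j => (L j).1, (L k).2)

/-- Handles one index set `E` with minimum `k`: generators of the ideal of `k`th entries of
relations on `E` lift to syzygies at the monomial `lcm(E)`, and multiples of their leading terms
give every required term. -/
theorem exists_finite_syzygies [IsCoherentRing R] {o : ModuleMonomialOrder n m}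
    {g : Fin p → FreeMod R n m} {L : Fin p → Mon n m} (hb : o.IsGroebnerBasis U g)
    (hL : ∀ j, o.IsLeadingMonomial (g j) (L j)) {k : Fin p} {E : Finset (Fin p)} (hkE : k ∈ E)
    (hmin : ∀ j ∈ E, k ≤ j) (hpos : ∀ j ∈ E, (L j).2 = (L k).2) :
    ∃ S : Set (FreeMod R n p), S.Finite ∧
      (∀ s ∈ S, s ∈ Syz (A := MvPolynomial (Fin n) R) g ∧
        (o.schreyerOfMon L).IsLeadingMonomial s ((lcmMon L k E).1 - (L k).1, k)) ∧
      ∀ b : Fin p → R, (∀ j, b j ≠ 0 → j ∈ E) → ∑ j, b j * coeffAt (g j) (L j) = 0 →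
        ∀ α, (lcmMon L k E).Dvd ((L k).shift α) → termAt (b k) (α, k) ∈
          Submodule.span (MvPolynomial (Fin n) R) ((o.schreyerOfMon L).lt '' S) := by
  classical
  -- Extension by zero outside `E`: entries of a relation there are unconstrained and get truncated,
  -- which leaves the `k`th entry unchanged because `k ∈ E`.
  let v : Fin p → R := fun j => if j ∈ E then coeffAt (g j) (L j) else 0
  have hsum : ∀ b : Fin p → R, b ∈ Syz (A := R) v ↔
      ∑ j, (if j ∈ E then b j else 0) * coeffAt (g j) (L j) = 0 := by
    intro b
    simp [Syz, Fintype.linearCombination_apply, v]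
  obtain ⟨B, hB⟩ := (IsCoherentRing.syz_fg v).map (LinearMap.proj (R := R) k)
  have hdvd : ∀ j ∈ E, (L j).Dvd (lcmMon L k E) := fun j hj =>
    ⟨hpos j hj, Finset.le_sup (f := fun j => (L j).1) hj⟩
  have hex : ∀ c ∈ B, c ≠ 0 → ∃ s ∈ Syz (A := MvPolynomial (Fin n) R) g,
      (o.schreyerOfMon L).IsLeadingMonomial s ((lcmMon L k E).1 - (L k).1, k) ∧
      coeffAt s ((lcmMon L k E).1 - (L k).1, k) = c := by
    intro c hc hc0
    have hcI : c ∈ (Syz (A := R) v).map (LinearMap.proj (R := R) k) :=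
      hB ▸ Submodule.subset_span hc
    obtain ⟨b, hb1, rfl⟩ := hcI
    have h := exists_syzygy hb hL (M := lcmMon L k E) (a := fun j => if j ∈ E then b j else 0)
      (k := k) (fun j hj => hdvd j (by_contra fun h => hj (if_neg h))) ((hsum b).1 hb1)
      (by simpa [hkE] using hc0)
      fun j hj => if_neg fun h => absurd (hmin j h) (not_le.2 hj)
    simpa [hkE] using h
  choose! f hf hfL hfc using hex
  refine ⟨f '' {c | c ∈ B ∧ c ≠ 0}, (B.finite_toSet.subset fun c hc => hc.1).image f, ?_, ?_⟩
  · rintro _ ⟨c, ⟨hc, hc0⟩, rfl⟩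
    exact ⟨hf c hc hc0, hfL c hc hc0⟩
  · intro b hbE hb0 α hα
    have hbv : b ∈ Syz (A := R) v := by
      rw [hsum]
      refine Eq.trans ?_ hb0
      refine Finset.sum_congr rfl fun j _ => ?_
      split_ifs with hj
      · rfl
      · rw [not_imp_comm.1 (hbE j) hj]
    have hbB : b k ∈ Submodule.span R (B : Set R) := hB ▸ ⟨b, hbv, rfl⟩
    -- Only membership of `b k` in the ideal matters from here on, which allows induction on the
    -- span.
    generalize b k = c at hbB
    induction hbB using Submodule.span_induction with
    | mem c hc =>
      by_cases hc0 : c = 0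
      · simp [hc0, termAt]
      · have hlt := (hfL c hc hc0).lt_eq
        rw [hfc c hc hc0] at hlt
        have heq : termAt c (α, k) = monomial (α + (L k).1 - (lcmMon L k E).1) (1 : R) •
            (o.schreyerOfMon L).lt (f c) := by
          rw [hlt, smul_termAt, one_mul]
          congr 1
          refine Prod.ext ?_ rfl
          simp only [Mon.shift]
          have h1 : (lcmMon L k E).1 ≤ α + (L k).1 := hα.2
          rw [← add_tsub_assoc_of_le (hdvd k hkE).2, tsub_add_cancel_of_le h1,
            add_tsub_cancel_right]
        rw [heq]
        exact Submodule.smul_mem _ _ (Submodule.subset_span ⟨f c, ⟨c, ⟨hc, hc0⟩, rfl⟩, rfl⟩)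
    | zero => simp [termAt]
    | add x y _ _ hx hy =>
      have : (termAt (x + y) (α, k) : FreeMod R n p) = termAt x (α, k) + termAt y (α, k) := by
        simp [termAt, ← Pi.single_add]
      rw [this]
      exact Submodule.add_mem _ hx hy
    | smul r x _ hx =>
      have : (termAt (r • x) (α, k) : FreeMod R n p) =
          (monomial 0 r : MvPolynomial (Fin n) R) • termAt x (α, k) := by
        rw [smul_termAt, Mon.shift, zero_add, smul_eq_mul]
      rw [this]
      exact Submodule.smul_mem _ _ hx

/-- Schreyer's theorem over a coherent ring: finitely many syzygies, with leading monomials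
`lcm(L_j : j ∈ E) / L_k` where `k = min E`, have leading terms that generate those of all
syzygies. -/
theorem exists_finite_mlt_syz [IsCoherentRing R] {o : ModuleMonomialOrder n m}
    {g : Fin p → FreeMod R n m} {L : Fin p → Mon n m} (hb : o.IsGroebnerBasis U g)
    (hL : ∀ j, o.IsLeadingMonomial (g j) (L j)) :
    ∃ S : Set (FreeMod R n p), S.Finite ∧ S ⊆ Syz (A := MvPolynomial (Fin n) R) g ∧
      (∀ s ∈ S, ∃ (k : Fin p) (E : Finset (Fin p)), (∀ j ∈ E, k ≤ j) ∧
        (o.schreyerOfMon L).IsLeadingMonomial s ((E.sup fun j => (L j).1) - (L k).1, k)) ∧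
      (o.schreyerOfMon L).mlt (Syz (A := MvPolynomial (Fin n) R) g) ≤
        Submodule.span _ ((o.schreyerOfMon L).lt '' S) := by
  classical
  -- There are finitely many pairs `(k, E)`, so the union of their finite sets of syzygies is
  -- finite.
  let Good : Set (Fin p × Finset (Fin p)) :=
    {x | x.1 ∈ x.2 ∧ (∀ j ∈ x.2, x.1 ≤ j) ∧ ∀ j ∈ x.2, (L j).2 = (L x.1).2}
  have hex := fun (x : Fin p × Finset (Fin p)) (hx : x ∈ Good) =>
    exists_finite_syzygies hb hL hx.1 hx.2.1 hx.2.2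
  choose! S hSfin hS hspan using hex
  refine ⟨⋃ x ∈ Good, S x, Good.toFinite.biUnion hSfin, ?_, ?_, ?_⟩
  · exact Set.iUnion₂_subset fun x hx s hs => (hS x hx s hs).1
  · intro s hs
    obtain ⟨x, hx, hs⟩ := Set.mem_iUnion₂.1 hs
    exact ⟨x.1, x.2, hx.2.1, (hS x hx s hs).2⟩
  · refine Submodule.span_le.2 ?_
    rintro _ ⟨u, hu, rfl⟩
    by_cases h0 : u = 0
    · simp [h0, lt]
    obtain ⟨⟨α, k⟩, hA⟩ := (o.schreyerOfMon L).exists_isLeadingMonomial u h0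
    rw [hA.lt_eq]
    set M := (L k).shift α with hM
    let E : Finset (Fin p) := {j | k ≤ j ∧ (L j).Dvd M}
    let b : Fin p → R := fun j => if (L j).Dvd M then (u j).coeff (M.1 - (L j).1) else 0
    have hmemE : ∀ j, j ∈ E ↔ k ≤ j ∧ (L j).Dvd M := by simp [E]
    have hbk : b k = coeffAt u (α, k) := by
      have hd : (L k).Dvd M := Mon.dvd_shift _ _
      simp only [b, if_pos hd, coeffAt]
      rw [hM, Mon.shift, add_tsub_cancel_right]
    have hgood : (k, E) ∈ Good :=
      ⟨(hmemE k).2 ⟨le_rfl, Mon.dvd_shift _ _⟩, fun j hj => ((hmemE j).1 hj).1,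
        fun j hj => ((hmemE j).1 hj).2.1⟩
    have hle : ∀ A : Mon n p, coeffAt u A ≠ 0 → o.Le ((L A.2).shift A.1) M := by
      intro A hAu
      rcases hA.2 A hAu with rfl | h | h
      · exact Or.inl rfl
      · exact Or.inr h
      · exact Or.inl h.1.symm
    -- An index `j < k` contributing at `M` would give a monomial of `u` above `X^α ε_k`, by the
    -- tie-break of Schreyer's order.
    have hbE : ∀ j, b j ≠ 0 → j ∈ E := by
      intro j hj
      have hd : (L j).Dvd M := by_contra fun h => hj (if_neg h)
      refine (hmemE j).2 ⟨?_, hd⟩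
      have hju : coeffAt u (M.1 - (L j).1, j) ≠ 0 := by
        simpa [b, hd, coeffAt] using hj
      rcases hA.2 _ hju with h | h | h
      · exact (congrArg Prod.snd h).ge
      · simp only [hd.shift_sub] at h
        exact absurd h (o.irrefl _)
      · exact h.2.le
    have hb0 : ∑ j, b j * coeffAt (g j) (L j) = 0 := by
      have h1 := coeffAt_linearCombination_top hL hle
      rw [show Fintype.linearCombination (MvPolynomial (Fin n) R) g u = 0 from hu] at h1
      refine Eq.trans ?_ (h1.symm.trans (by simp [coeffAt]))
      exact Finset.sum_congr rfl fun j _ => by simp [b]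
    rw [← hbk]
    refine Submodule.span_mono (Set.image_mono (Set.subset_biUnion_of_mem hgood))
      (hspan _ hgood b hbE hb0 α ⟨rfl, Finset.sup_le fun j hj => ((hmemE j).1 hj).2.2⟩)

end ModuleMonomialOrder

/-! ### Removing one variable per step, and the resolution -/

/-- A Gröbner basis whose leading monomials involve none of the variables of index less than `i`
and are listed with decreasing exponents of the variable of index `i`. -/
structure SortedGroebnerBasis (R : Type*) [CommRing R] (n i : ℕ) where
  rank : ℕ
  o : ModuleMonomialOrder n rank
  U : Submodule (MvPolynomial (Fin n) R) (FreeMod R n rank)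
  p : ℕ
  g : Fin p → FreeMod R n rank
  ne_zero : ∀ j, g j ≠ 0
  isGroebnerBasis : o.IsGroebnerBasis U g
  lm_eq_zero : ∀ (j : Fin p) (v : Fin n), v.val < i → (o.lm (g j) (ne_zero j)).1 v = 0
  lm_antitone : ∀ (v : Fin n), v.val = i → Antitone fun j => (o.lm (g j) (ne_zero j)).1 v

namespace SortedGroebnerBasis

variable {R : Type*} [CommRing R] {n i : ℕ}

theorem exists_of_finite {m : ℕ} {o : ModuleMonomialOrder n m}
    {U : Submodule (MvPolynomial (Fin n) R) (FreeMod R n m)} {S : Set (FreeMod R n m)}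
    (hS : S.Finite) (hSU : S ⊆ U) (hne : ∀ s ∈ S, s ≠ 0)
    (hspan : o.mlt U ≤ Submodule.span _ (o.lt '' S))
    (hlm : ∀ (s) (hs : s ∈ S) (v : Fin n), v.val < i → (o.lm s (hne s hs)).1 v = 0) :
    ∃ (p : ℕ) (g : Fin p → FreeMod R n m) (hg : ∀ j, g j ≠ 0), o.IsGroebnerBasis U g ∧
      (∀ (j : Fin p) (v : Fin n), v.val < i → (o.lm (g j) (hg j)).1 v = 0) ∧
      ∀ (v : Fin n), v.val = i → Antitone fun j => (o.lm (g j) (hg j)).1 v := by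
  obtain ⟨p, g, hg, hb, hgS, hanti⟩ :=
    ModuleMonomialOrder.exists_isGroebnerBasis_antitone hS hSU hne hspan
      -- Once `i ≥ n` no variable is left to sort by, and a constant key imposes nothing.
      fun M => if h : i < n then M.1 ⟨i, h⟩ else 0
  refine ⟨p, g, hg, hb, fun j => hlm _ (hgS j), ?_⟩
  rintro v rfl
  simpa using hanti

/-- In `lcm(L_j : j ∈ E) / L_k` the variables of index below `i` are absent already, and the one of
index `i` cancels because `k = min E` has the largest exponent; the new basis is then sorted by the
next variable. -/
theorem exists_next [IsCoherentRing R] (s : SortedGroebnerBasis R n i) :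
    ∃ (p : ℕ) (g : Fin p → FreeMod R n s.p) (hg : ∀ j, g j ≠ 0),
      (s.o.schreyer s.g s.ne_zero).IsGroebnerBasis (Syz (A := MvPolynomial (Fin n) R) s.g) g ∧
      (∀ (j : Fin p) (v : Fin n), v.val < i + 1 →
        ((s.o.schreyer s.g s.ne_zero).lm (g j) (hg j)).1 v = 0) ∧
      ∀ (v : Fin n), v.val = i + 1 →
        Antitone fun j => ((s.o.schreyer s.g s.ne_zero).lm (g j) (hg j)).1 v := by
  obtain ⟨S, hS, hSU, hlm, hspan⟩ :=
    ModuleMonomialOrder.exists_finite_mlt_syz s.isGroebnerBasis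
      fun j => s.o.isLeadingMonomial_lm (s.g j) (s.ne_zero j)
  have hne : ∀ u ∈ S, u ≠ 0 := fun u hu => by
    obtain ⟨_, _, _, h⟩ := hlm u hu
    exact ne_zero_of_coeffAt h.1
  refine exists_of_finite hS hSU hne hspan fun u hu v hv => ?_
  obtain ⟨k, E, hE, h⟩ := hlm u hu
  rw [show (s.o.schreyer s.g s.ne_zero).lm u (hne u hu) = _ from h.lm_eq _, Finsupp.tsub_apply,
    tsub_eq_zero_iff_le]
  have hsup : ∀ f : Fin s.p → Fin n →₀ ℕ, (E.sup f) v = E.sup fun j => f j v := fun f =>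
    Finset.apply_sup_eq_sup_comp (fun a : Fin n →₀ ℕ => a v) (fun _ _ => rfl) rfl
  rw [hsup]
  refine Finset.sup_le fun j hj => ?_
  rcases (Nat.lt_succ_iff_lt_or_eq.1 hv) with h1 | h1
  · rw [s.lm_eq_zero j v h1]
    exact Nat.zero_le _
  · exact s.lm_antitone v h1 (hE j hj)

/-- The Gröbner basis of the syzygies of a sorted Gröbner basis. -/
def next [IsCoherentRing R] (s : SortedGroebnerBasis R n i) : SortedGroebnerBasis R n (i + 1) where
  rank := s.p
  o := s.o.schreyer s.g s.ne_zero
  U := Syz s.g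
  p := s.exists_next.choose
  g := s.exists_next.choose_spec.choose
  ne_zero := s.exists_next.choose_spec.choose_spec.choose
  isGroebnerBasis := s.exists_next.choose_spec.choose_spec.choose_spec.1
  lm_eq_zero := s.exists_next.choose_spec.choose_spec.choose_spec.2.1
  lm_antitone := s.exists_next.choose_spec.choose_spec.choose_spec.2.2

/-- The iterated Gröbner bases of syzygies. -/
def iter [IsCoherentRing R] (s : SortedGroebnerBasis R n 0) : ∀ i, SortedGroebnerBasis R n i
  | 0 => s
  | i + 1 => (iter s i).next

/-- The tower of iterated Gröbner bases of syzygies. -/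
def tower [IsCoherentRing R] (s : SortedGroebnerBasis R n 0) : Tower R n s.rank where
  p i := (s.iter i).p
  -- Splitting the index lets `towerRank` reduce, so that it matches `rank` definitionally.
  G
    | 0 => s.g
    | i + 1 => (s.iter (i + 1)).g
  ne_zero
    | 0 => s.ne_zero
    | i + 1 => (s.iter (i + 1)).ne_zero

theorem tower_order_succ [IsCoherentRing R] (s : SortedGroebnerBasis R n 0) (i : ℕ) :
    s.tower.order s.o (i + 1) = (s.iter (i + 1)).o := by
  induction i with
  | zero => rfl
  | succ i ih =>
    rw [Tower.order, ih]
    rfl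

theorem tower_isIteratedSyzygies [IsCoherentRing R] (s : SortedGroebnerBasis R n 0) (q : ℕ) :
    s.tower.IsIteratedSyzygies s.o s.U q := by
  refine ⟨s.isGroebnerBasis, fun i _ => ?_⟩
  rw [tower_order_succ]
  cases i with
  | zero => exact (s.iter 1).isGroebnerBasis
  | succ i => exact (s.iter (i + 2)).isGroebnerBasis

end SortedGroebnerBasis

/-- The kernel of each map is `Syz(G_i) = ⟨G_{i+1}⟩`, the image of the next map; at the last stage
this kernel is exactly the `V` that is divided out. -/
theorem Tower.IsIteratedSyzygies.isResolution {R : Type*} [CommRing R] {n m : ℕ}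
    {T : Tower R n m} {o : ModuleMonomialOrder n m}
    {U : Submodule (MvPolynomial (Fin n) R) (FreeMod R n m)} {k : ℕ}
    (h : T.IsIteratedSyzygies o U (k + 1)) : T.IsResolution U k := by
  have hker : ∀ i < k + 1, T.gen (i + 1) = LinearMap.ker (T.d i) := fun i hi =>
    (h.2 i hi).span_eq
  have hrange : ∀ i, LinearMap.range (T.d i) = T.gen i := fun i =>
    Fintype.range_linearCombination _ _
  refine ⟨⟨(hker k k.lt_succ_self).le, ?_⟩, fun i hi => ?_, ?_, U.mkQ_surjective⟩
  · rw [← LinearMap.ker_eq_bot, Submodule.ker_liftQ_eq_bot']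
    exact hker k k.lt_succ_self
  · rw [LinearMap.exact_iff, hrange, hker i (hi.trans k.lt_succ_self)]
  · exact LinearMap.exact_iff.2 (U.ker_mkQ.trans (h.1.span_eq.symm.trans (hrange 0).symm))

end

theorem mainTheorem4 {R : Type*} [CommRing R] [StronglyDiscrete R] [IsCoherentRing R]
    (n m : ℕ) (o : ModuleMonomialOrder n m)
    (U : Submodule (MvPolynomial (Fin n) R) (FreeMod R n m)) (hU : U.FG) (hMLT : (o.mlt U).FG) :
    ∃ (q k : ℕ) (T : Tower R n m), q = k + 1 ∧ q ≤ n + 1 ∧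
      T.IsResolution U k ∧
      T.IsIteratedSyzygies o U q ∧
      ∀ j : Fin (T.p q), ((T.order o q).lm (T.G q j) (T.ne_zero q j)).1 = 0 := by
  obtain ⟨S, hS, hSU, hne, hspan⟩ := ModuleMonomialOrder.exists_finite_of_mlt_fg hMLT
  obtain ⟨p, g, hg, hb, hzero, hanti⟩ := SortedGroebnerBasis.exists_of_finite (i := 0) hS hSU hne
    hspan fun _ _ _ hv => absurd hv (Nat.not_lt_zero _)
  let s : SortedGroebnerBasis R n 0 := ⟨m, o, U, p, g, hg, hb, hzero, hanti⟩
  -- The leading monomials of `G_n` are already free of variables; taking `q = n + 1` also ensures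
  -- `q ≥ 1` when `n = 0`.
  refine ⟨n + 1, n, s.tower, rfl, le_rfl, (s.tower_isIteratedSyzygies (n + 1)).isResolution,
    s.tower_isIteratedSyzygies (n + 1), fun j => Finsupp.ext fun v => ?_⟩
  have h := s.tower_order_succ n
  change s.tower.order o (n + 1) = _ at h
  rw [h]
  exact (s.iter (n + 1)).lm_eq_zero j v (v.2.trans n.lt_succ_self)
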